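/- Conventions. $\mathcal{C}at$ is the 2-category of small categories and $\mathcal{CAT}$ the 2-category of large categories; $\mathbb 1$ is the terminal category and $\mathbb 2=(0\to 1)$; $\Box=\mathbb 2\times\mathbb 2$, $\ulcorner\subset\Box$ is the full subcategory on all objects except $(1,1)$, and $i_\ulcorner\colon\ulcorner\to\Box$ is the inclusion. For a 2-functor $\mathscr D\colon\mathcal{C}at^{\mathrm{op}}\to\mathcal{CAT}$ (contravariant on functors, covariant on natural transformations) and a functor $u\colon A\to B$ write $u^*=\mathscr D(u)\colon\mathscr D(B)\to\mathscr D(A)$. A *derivator* is a 2-functor $\mathscr D\colon\mathcal{C}at^{\mathrm{op}}\to\mathcal{CAT}$ such that - (Der1) for every small family $(A_i)_{i\in I}$ of small categories the canonical functor $\mathscr D(\coprod_i A_i)\to\prod_i\mathscr D(A_i)$ is an equivalence; - (Der2) for every small category $A$, a morphism $\varphi$ of $\mathscr D(A)$ is invertible if $a^*\varphi$ is invertible in $\mathscr D(\mathbb 1)$ for every object $a\colon\mathbb 1\to A$; - (Der3) every $u^*$ has a left adjoint $u_!$ and a right adjoint $u_*$; - (Der4) for functors $u\colon A\to C$, $v\colon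 B\to C$ with comma category $(u/v)$ and projections $p\colon(u/v)\to A$, $q\colon(u/v)\to B$, the canonical mate $q_!p^*\to v^*u_!$ is invertible if $B=\mathbb 1$, and the canonical mate $u^*v_*\to p_*q^*$ is invertible if $A=\mathbb 1$. It is *pointed* if $\mathscr D(\mathbb 1)$ has a zero object. For a small category $B$ the *shifted derivator* $\mathscr D^B$ is given by $\mathscr D^B(A)=\mathscr D(B\times A)$, so that $\mathscr D^B(\mathbb 1)=\mathscr D(B\times\mathbb 1)\cong\mathscr D(B)$ by restriction along the isomorphism $B\cong B\times\mathbb 1$; it is pointed if $\mathscr D$ is. The *suspension functor* of a pointed derivator $\mathscr D$ is the composite $$\Sigma\colon\ \mathscr D(\mathbb 1)\xrightarrow{(0,0)_*}\mathscr D(\ulcorner)\xrightarrow{(i_\ulcorner)_!}\mathscr D(\Box)\xrightarrow{(1,1)^*}\mathscr D(\mathbb 1),$$ and its *cofiber functor* is the composite $$\mathsf{cof}\colon\ \mathscr D(\mathbb 2)\xrightarrow{(0,-)_*}\mathscr D(\ulcorner)\xrightarrow{(i_\ulcorner)_!}\mathscr D(\Box)\xrightarrow{(-,1)^*}\mathscr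 D(\mathbb 2),$$ where $(0,-)\colon\mathbb 2\to\ulcorner$ and $(-,1)\colon\mathbb 2\to\Box$ are the inclusions of the objects with first coordinate $0$, respectively second coordinate $1$. **Lemma.** Let $\mathscr D$ be a pointed derivator. Then the functor $\mathsf{cof}^3=\mathsf{cof}\circ\mathsf{cof}\circ\mathsf{cof}\colon\mathscr D(\mathbb 2)\to\mathscr D(\mathbb 2)$ is naturally isomorphic to the suspension functor $\Sigma$ of the shifted derivator $\mathscr D^{\mathbb 2}$, regarded as a functor $\mathscr D(\mathbb 2)\to\mathscr D(\mathbb 2)$ through the isomorphism $\mathscr D^{\mathbb 2}(\mathbb 1)=\mathscr D(\mathbb 2\times\mathbb 1)\cong\mathscr D(\mathbb 2)$. -/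

import Mathlib

open CategoryTheory Opposite

universe w v u

/-! ## Prederivators and restriction functors -/

set_option linter.checkUnivs false in
/-- A prederivator: a (strict) 2-functor `D : Catᵒᵖ ⥤ CAT`. Here `Catᵒᵖ` is the 2-category of small
categories with the direction of 1-cells reversed and the direction of 2-cells kept. -/
abbrev Prederivator : Type _ :=
  StrictPseudofunctor (Cat.{w, w}ᵒᵖ) Cat.{v, u}

namespace Prederivator

/-- The terminal category `𝟙`. -/
abbrev One : Type w := Discrete PUnit.{w + 1}

/-- The category `𝟚 = (0 ⟶ 1)`, as the category of the two-element linear order. -/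
abbrev Two : Type w := ULift.{w} (Fin 2)

/-- The category `□ = 𝟚 × 𝟚`. -/
abbrev Square : Type w := Two.{w} × Two.{w}

/-- The category `⌜`: the full subcategory of `□` on all objects except `(1, 1)`. -/
abbrev Corner : Type w :=
  ObjectProperty.FullSubcategory (fun p : Square.{w} => p ≠ (⟨1⟩, ⟨1⟩))

/-- The inclusion `⌜ ⥤ □`. -/
abbrev Corner.incl : Corner.{w} ⥤ Square.{w} := ObjectProperty.ι _

/-- The object `a` of `A`, as a functor `𝟙 ⥤ A`. -/
abbrev pt {A : Type w} [Category.{w} A] (a : A) : One.{w} ⥤ A := (Functor.const _).obj a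

/-- The object `(0, 0)` of `⌜`. -/
abbrev Corner.zero : Corner.{w} := ⟨(⟨0⟩, ⟨0⟩), by simp⟩

/-- The inclusion `(0, -) : 𝟚 ⥤ ⌜` of the objects with first coordinate `0`. -/
abbrev Corner.row : Two.{w} ⥤ Corner.{w} :=
  ObjectProperty.lift _ (Prod.sectR (⟨0⟩ : Two.{w}) Two.{w}) (by simp)

/-- The inclusion `(-, 1) : 𝟚 ⥤ □` of the objects with second coordinate `1`. -/
abbrev Square.col : Two.{w} ⥤ Square.{w} := Prod.sectL Two.{w} (⟨1⟩ : Two.{w})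

section

variable (D : Prederivator.{w, v, u})
variable {A B C E : Type w} [Category.{w} A] [Category.{w} B] [Category.{w} C] [Category.{w} E]

/-- The category `D(A)` of coherent `A`-shaped diagrams. -/
abbrev diag (A : Type w) [Category.{w} A] : Type u := D.obj (op (Cat.of A))

/-- Restriction `f^* : D(B) ⥤ D(A)` along `f : A ⥤ B`. -/
def pull (f : A ⥤ B) : D.diag B ⥤ D.diag A := (D.map f.toCatHom.op).toFunctor

/-- The transformation `α^* : f^* ⟶ g^*` induced by `α : f ⟶ g`. -/
def pull₂ {f g : A ⥤ B} (α : f ⟶ g) : D.pull f ⟶ D.pull g :=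
  (D.map₂ (Bicategory.Opposite.op2 α.toCatHom₂)).toNatTrans

/-- Functoriality of restriction: `(f ⋙ g)^* = g^* ⋙ f^*`, as the isomorphism that is part of the
2-functor `D` (it is the one given by the equality of both sides). -/
def pullComp (f : A ⥤ B) (g : B ⥤ C) : D.pull (f ⋙ g) ≅ D.pull g ⋙ D.pull f :=
  Cat.Hom.toNatIso (D.mapComp g.toCatHom.op f.toCatHom.op)

/-- The transformation `p^* f^* ⟶ q^* g^*` induced by a 2-cell `α` from `p ⋙ f` to `q ⋙ g`. -/
def pullSquare {p : E ⥤ A} {q : E ⥤ B} {f : A ⥤ C} {g : B ⥤ C} (α : p ⋙ f ⟶ q ⋙ g) :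
    D.pull f ⋙ D.pull p ⟶ D.pull g ⋙ D.pull q :=
  (D.pullComp p f).inv ≫ D.pull₂ α ≫ (D.pullComp q g).hom

/-! ## Kan extensions, derivators -/

/-- (Der3): all restriction functors have a left and a right adjoint. -/
class HasKanExtensions : Prop where
  isRightAdjoint {A B : Type w} [Category.{w} A] [Category.{w} B] (f : A ⥤ B) :
    (D.pull f).IsRightAdjoint
  isLeftAdjoint {A B : Type w} [Category.{w} A] [Category.{w} B] (f : A ⥤ B) :
    (D.pull f).IsLeftAdjoint

attribute [instance] HasKanExtensions.isRightAdjoint HasKanExtensions.isLeftAdjoint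

section Kan

variable [D.HasKanExtensions]

/-- The left Kan extension `f_! : D(A) ⥤ D(B)`, left adjoint to `f^*`. -/
noncomputable def lan (f : A ⥤ B) : D.diag A ⥤ D.diag B := (D.pull f).leftAdjoint

/-- The adjunction `f_! ⊣ f^*`. -/
noncomputable def lanAdj (f : A ⥤ B) : D.lan f ⊣ D.pull f :=
  Adjunction.ofIsRightAdjoint (D.pull f)

/-- The right Kan extension `f_* : D(A) ⥤ D(B)`, right adjoint to `f^*`. -/
noncomputable def ran (f : A ⥤ B) : D.diag A ⥤ D.diag B := (D.pull f).rightAdjoint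

/-- The adjunction `f^* ⊣ f_*`. -/
noncomputable def ranAdj (f : A ⥤ B) : D.pull f ⊣ D.ran f :=
  Adjunction.ofIsLeftAdjoint (D.pull f)

/-- The mate `q_! p^* ⟶ g^* f_!` of the transformation induced by `α`, that is the composite
`q_! p^* ⟶ q_! p^* f^* f_! ⟶ q_! q^* g^* f_! ⟶ g^* f_!`. -/
noncomputable def lanMate {p : E ⥤ A} {q : E ⥤ B} {f : A ⥤ C} {g : B ⥤ C}
    (α : p ⋙ f ⟶ q ⋙ g) : D.pull p ⋙ D.lan q ⟶ D.lan f ⋙ D.pull g :=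
  ((mateEquiv (D.lanAdj f) (D.lanAdj q)).symm (TwoSquare.mk _ _ _ _ (D.pullSquare α))).natTrans

/-- The mate `f^* g_* ⟶ p_* q^*` of the transformation induced by `α`, that is the composite
`f^* g_* ⟶ p_* p^* f^* g_* ⟶ p_* q^* g^* g_* ⟶ p_* q^*`. -/
noncomputable def ranMate {p : E ⥤ A} {q : E ⥤ B} {f : A ⥤ C} {g : B ⥤ C}
    (α : p ⋙ f ⟶ q ⋙ g) : D.ran g ⋙ D.pull f ⟶ D.pull q ⋙ D.ran p :=
  (mateEquiv (D.ranAdj g) (D.ranAdj p) (TwoSquare.mk _ _ _ _ (D.pullSquare α))).natTrans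

end Kan

/-- A derivator: a prederivator satisfying (Der1)-(Der4). -/
class IsDerivator : Prop extends D.HasKanExtensions where
  /-- (Der1): `D` takes coproducts to products, i.e. the canonical functor
  `D(∐ i, A i) ⥤ ∏ i, D(A i)` is an equivalence for every small family of small categories. -/
  coprod (I : Type w) (A : I → Type w) [∀ i, Category.{w} (A i)] :
    (Functor.pi' fun i => D.pull (Sigma.incl (C := A) i)).IsEquivalence
  /-- (Der2): the functors `a^* : D(A) ⥤ D(𝟙)`, for `a` in `A`, are jointly conservative. -/
  conservative {A : Type w} [Category.{w} A] {X Y : D.diag A} (φ : X ⟶ Y)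
    (h : ∀ a : A, IsIso ((D.pull (pt a)).map φ)) : IsIso φ
  /-- (Der4), for left Kan extensions: the canonical mate `q_! p^* ⟶ g^* f_!` for the comma
  category of `f` over an object `g` of `C`. -/
  lan_pointwise {A C : Type w} [Category.{w} A] [Category.{w} C] (f : A ⥤ C) (g : One.{w} ⥤ C) :
    IsIso (D.lanMate (Comma.natTrans f g))
  /-- (Der4), for right Kan extensions: the canonical mate `f^* g_* ⟶ p_* q^*` for the comma
  category of `g` under an object `f` of `C`. -/
  ran_pointwise {B C : Type w} [Category.{w} B] [Category.{w} C] (f : One.{w} ⥤ C) (g : B ⥤ C) :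
    IsIso (D.ranMate (Comma.natTrans f g))

/-- A derivator is pointed if its underlying category `D(𝟙)` has a zero object. -/
class IsPointedDerivator : Prop extends D.IsDerivator where
  hasZeroObject : Limits.HasZeroObject (D.diag One.{w})

/-! ## Suspension and cofiber -/

section

variable [D.HasKanExtensions]

/-- The suspension functor `Σ`, the composite of `(0,0)_* : D(𝟙) ⥤ D(⌜)`,
`i_! : D(⌜) ⥤ D(□)` and `(1,1)^* : D(□) ⥤ D(𝟙)`. -/
noncomputable def suspension : D.diag One.{w} ⥤ D.diag One.{w} :=
  D.ran (pt Corner.zero.{w}) ⋙ D.lan Corner.incl.{w} ⋙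
    D.pull (pt ((⟨1⟩, ⟨1⟩) : Square.{w}))

/-- The cofiber functor, the composite of `(0,-)_* : D(𝟚) ⥤ D(⌜)`,
`i_! : D(⌜) ⥤ D(□)` and `(-,1)^* : D(□) ⥤ D(𝟚)`. -/
noncomputable def cofiber : D.diag Two.{w} ⥤ D.diag Two.{w} :=
  D.ran Corner.row.{w} ⋙ D.lan Corner.incl.{w} ⋙ D.pull Square.col.{w}

end

end

/-! ## Shifted prederivators -/

/-- The 2-functor `B × -` on small categories, as a 2-functor `Catᵒᵖ ⥤ Catᵒᵖ`. -/
def prodLeft (B : Type w) [Category.{w} B] :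
    StrictPseudofunctor (Cat.{w, w}ᵒᵖ) (Cat.{w, w}ᵒᵖ) :=
  StrictPseudofunctor.mk'
    { obj := fun A => op (Cat.of (B × A.unop))
      map := fun f => ((𝟭 B).prod f.unop.toFunctor).toCatHom.op
      map₂ := fun α => Bicategory.Opposite.op2
        (NatTrans.toCatHom₂ (NatTrans.prod (𝟙 (𝟭 B)) α.unop2.toNatTrans))
      map₂_id := by
        intros; rfl
      map₂_comp := by
        intros
        refine congrArg Bicategory.Opposite.op2 (Cat.Hom₂.ext (NatTrans.ext (funext fun x => ?_)))
        exact Prod.ext (Category.id_comp _).symm rfl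
      map_id := by
        intros; rfl
      map_comp := by
        intros; rfl
      map₂_whisker_left := by
        intro a b c f g g' η
        refine Eq.trans (?_ : _ = _) ((Category.id_comp _).trans (Category.comp_id _)).symm
        refine congrArg Bicategory.Opposite.op2 (Cat.Hom₂.ext (NatTrans.ext (funext fun x => ?_)))
        exact Prod.ext rfl rfl
      map₂_whisker_right := by
        intro a b c f f' η g
        refine Eq.trans (?_ : _ = _) ((Category.id_comp _).trans (Category.comp_id _)).symm
        refine congrArg Bicategory.Opposite.op2 (Cat.Hom₂.ext (NatTrans.ext (funext fun x => ?_)))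
        exact Prod.ext rfl rfl
      map₂_left_unitor := by
        intro a b f
        refine Eq.trans ?_ (Category.id_comp _).symm
        rfl
      map₂_right_unitor := by
        intro a b f
        refine Eq.trans ?_ (Category.id_comp _).symm
        rfl
      map₂_associator := by
        intro a b c d f g h
        refine Eq.trans ?_ ((Category.id_comp _).trans (Category.comp_id _)).symm
        rfl }

/-- The shifted prederivator `D^B`, with `D^B(A) = D(B × A)`. -/
def shift (D : Prederivator.{w, v, u}) (B : Type w) [Category.{w} B] : Prederivator.{w, v, u} :=
  (prodLeft B).comp D


/-- If `D` has Kan extensions then so does `D^B`. -/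
instance shift_hasKanExtensions (D : Prederivator.{w, v, u}) (B : Type w) [Category.{w} B]
    [D.HasKanExtensions] : (D.shift B).HasKanExtensions where
  isRightAdjoint f := HasKanExtensions.isRightAdjoint (D := D) ((𝟭 B).prod f)
  isLeftAdjoint f := HasKanExtensions.isLeftAdjoint (D := D) ((𝟭 B).prod f)

/-- The identity functor of `A` induces the identity of `D(A)`, as the isomorphism that is part of
the 2-functor `D` (it is the one given by the equality of both sides). -/
def pullId (D : Prederivator.{w, v, u}) (A : Type w) [Category.{w} A] :
    D.pull (𝟭 A) ≅ 𝟭 (D.diag A) :=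
  Cat.Hom.toNatIso (D.mapId (op (Cat.of A)))

/-- The identification of the underlying category `D^B(𝟙) = D(B × 𝟙)` of `D^B` with `D(B)`:
restriction along the mutually inverse isomorphisms of categories `B ⥤ B × 𝟙` and `B × 𝟙 ⥤ B`. -/
def shiftUnderlying (D : Prederivator.{w, v, u}) (B : Type w) [Category.{w} B] :
    (D.shift B).diag One.{w} ≌ D.diag B :=
  CategoryTheory.Equivalence.mk
    (D.pull (Prod.sectL B (⟨⟨⟩⟩ : One.{w}))) (D.pull (CategoryTheory.Prod.fst B One.{w}))
    ((D.pullId (B × One.{w})).symm ≪≫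
      D.pullComp (CategoryTheory.Prod.fst B One.{w}) (Prod.sectL B (⟨⟨⟩⟩ : One.{w})))
    ((D.pullComp (Prod.sectL B (⟨⟨⟩⟩ : One.{w})) (CategoryTheory.Prod.fst B One.{w})).symm ≪≫
      D.pullId B)

end Prederivator

/-!
Let `f : x ⟶ y` be an object of `D(𝟚)`. Insert zero objects by a right Kan extension along a sieve
(as the terminal objects that it produces) and pushouts by a left Kan extension, so as to obtain a
coherent diagram on the `3 × 3` grid, `gridDiag`, with rows `x ⟶ y ⟶ 0`, `0 ⟶ cof f ⟶ Σ x` and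
`0 ⟶ 0 ⟶ Σ y`. The squares `(x, y, 0, cof f)`, `(y, cof f, 0, Σ x)` and `(cof f, Σ x, 0, Σ y)` are
cocartesian, so that the arrow `Σ x ⟶ Σ y` of the diagram is the third iterated cofiber of `f`. On
the other hand, `(x, 0, 0, Σ x)` and `(y, 0, 0, Σ y)` are cocartesian as well, and the grid contains
the map `𝟚 × □ ⥤ Grid` from the former to the latter. Hence the same arrow `Σ x ⟶ Σ y` is the
suspension of `f` in `D^𝟚`.

That a square of the grid is cocartesian is a finality statement: if the grid diagram is left Kan
extended from a subposet `s`, then its value at the last vertex `v` of the square is the colimit over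
the part of `s` below `v`, and it is enough that the corner of the square is reflective there
(`isColim_pull_of_mem_essImage_lan`, `IsPushoutShape`). The subposet `s` may be enlarged by vertices
that have already been filled in (`gridDiag_mem_essImage`), which takes care of the three
consecutive squares. The reflectivity is a finite check.

Colimits are handled through maps into an arbitrary object (`IsColim`), which turns (Der4) into a
bijection (`lan_bijective`). Kan extensions along fully faithful functors are then detected at the
objects outside of the image (`isIso_lanAdj_counit_app`, `isIso_ranAdj_unit_app`), and a diagram that
passes these tests is determined by its restriction (`isoRanLan`). Suspension and cofiber are
composites of such Kan extensions, for `D^𝟚` along the product functors `𝟚 × -`.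
-/

namespace Prederivator

/-! ### Coherence of restriction functors -/

section Coherence

variable (D : Prederivator.{w, v, u})
variable {A B C E : Type w} [Category.{w} A] [Category.{w} B] [Category.{w} C] [Category.{w} E]

lemma pull_comp (f : A ⥤ B) (g : B ⥤ C) : D.pull (f ⋙ g) = D.pull g ⋙ D.pull f :=
  congrArg Cat.Hom.toFunctor (D.map_comp g.toCatHom.op f.toCatHom.op)

lemma pull_id (A : Type w) [Category.{w} A] : D.pull (𝟭 A) = 𝟭 (D.diag A) :=
  congrArg Cat.Hom.toFunctor (D.map_id (op (Cat.of A)))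

lemma pull_comp_obj (f : A ⥤ B) (g : B ⥤ C) (X : D.diag C) :
    (D.pull (f ⋙ g)).obj X = (D.pull f).obj ((D.pull g).obj X) := by
  rw [pull_comp]; rfl

lemma pull_comp₃_obj (f : A ⥤ B) (g : B ⥤ C) (h : C ⥤ E) (X : D.diag E) :
    (D.pull (f ⋙ g ⋙ h)).obj X = (D.pull f).obj ((D.pull g).obj ((D.pull h).obj X)) := by
  rw [pull_comp_obj, pull_comp_obj]

lemma pull_congr_obj {f g : A ⥤ B} (h : f = g) (X : D.diag B) :
    (D.pull f).obj X = (D.pull g).obj X := by rw [h]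

/-- As `D` is strict, its structural isomorphisms are of the form `eqToHom`; their coherence is then
proof irrelevance. -/
lemma pullComp_hom_app (f : A ⥤ B) (g : B ⥤ C) (X : D.diag C) :
    (D.pullComp f g).hom.app X = eqToHom (D.pull_comp_obj f g X) := by
  simp only [pullComp, StrictPseudofunctor.mapComp_eq_eqToIso]
  exact Cat.eqToHom_app _ _ _ X

lemma pullComp_inv_app (f : A ⥤ B) (g : B ⥤ C) (X : D.diag C) :
    (D.pullComp f g).inv.app X = eqToHom (D.pull_comp_obj f g X).symm := by
  simp only [pullComp, StrictPseudofunctor.mapComp_eq_eqToIso]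
  exact Cat.eqToHom_app _ _ _ X

lemma pull_map_comp (f : A ⥤ B) (g : B ⥤ C) {X Y : D.diag C} (φ : X ⟶ Y) :
    (D.pull (f ⋙ g)).map φ = eqToHom (D.pull_comp_obj f g X) ≫ (D.pull f).map ((D.pull g).map φ) ≫
      eqToHom (D.pull_comp_obj f g Y).symm := by
  have := (D.pullComp f g).hom.naturality φ
  rw [pullComp_hom_app, pullComp_hom_app] at this
  rw [← Category.assoc, ← Functor.comp_map, ← this]
  simp

lemma pull_map_congr {f g : A ⥤ B} (h : f = g) {X Y : D.diag B} (φ : X ⟶ Y) :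
    (D.pull f).map φ = eqToHom (D.pull_congr_obj h X) ≫ (D.pull g).map φ ≫
      eqToHom (D.pull_congr_obj h Y).symm := by
  subst h; simp

lemma pull_map_id {X Y : D.diag A} (φ : X ⟶ Y) :
    (D.pull (𝟭 A)).map φ = eqToHom (by rw [pull_id]; rfl) ≫ φ ≫
      eqToHom (by rw [pull_id]; rfl) := by
  exact Functor.congr_hom (D.pull_id A) φ

lemma pull₂_id (f : A ⥤ B) : D.pull₂ (𝟙 f) = 𝟙 (D.pull f) := by
  have := D.map₂_id f.toCatHom.op
  exact congrArg Cat.Hom₂.toNatTrans this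

lemma pull₂_comp {f g h : A ⥤ B} (α : f ⟶ g) (β : g ⟶ h) :
    D.pull₂ (α ≫ β) = D.pull₂ α ≫ D.pull₂ β := by
  have := D.map₂_comp (Bicategory.Opposite.op2 α.toCatHom₂) (Bicategory.Opposite.op2 β.toCatHom₂)
  exact congrArg Cat.Hom₂.toNatTrans this

lemma pull₂_eqToHom {f g : A ⥤ B} (h : f = g) (X : D.diag B) :
    (D.pull₂ (eqToHom h)).app X = eqToHom (D.pull_congr_obj h X) := by
  subst h; simp [pull₂_id]

lemma pull₂_whiskerLeft_app (l : A ⥤ B) {f g : B ⥤ C} (α : f ⟶ g) (X : D.diag C) :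
    (D.pull₂ (Functor.whiskerLeft l α)).app X = eqToHom (D.pull_comp_obj l f X) ≫
      (D.pull l).map ((D.pull₂ α).app X) ≫ eqToHom (D.pull_comp_obj l g X).symm := by
  have := D.map₂_whisker_right (Bicategory.Opposite.op2 α.toCatHom₂) l.toCatHom.op
  have := congrArg (fun t => (Cat.Hom₂.toNatTrans t).app X) this
  simp only [StrictPseudofunctor.mapComp_eq_eqToIso] at this
  refine this.trans ?_
  simp only [eqToIso.hom, eqToIso.inv, Cat.Hom₂.comp_app, Cat.eqToHom_app]
  rfl

lemma pull₂_whiskerRight_app {f g : A ⥤ B} (α : f ⟶ g) (j : B ⥤ C) (X : D.diag C) :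
    (D.pull₂ (Functor.whiskerRight α j)).app X = eqToHom (D.pull_comp_obj f j X) ≫
      (D.pull₂ α).app ((D.pull j).obj X) ≫ eqToHom (D.pull_comp_obj g j X).symm := by
  have := D.map₂_whisker_left j.toCatHom.op (Bicategory.Opposite.op2 α.toCatHom₂)
  have := congrArg (fun t => (Cat.Hom₂.toNatTrans t).app X) this
  simp only [StrictPseudofunctor.mapComp_eq_eqToIso] at this
  refine this.trans ?_
  simp only [eqToIso.hom, eqToIso.inv, Cat.Hom₂.comp_app, Cat.eqToHom_app]
  rfl

lemma isIso_pull_map_of_eq {f g : A ⥤ B} (h : f = g) {X Y : D.diag B} (φ : X ⟶ Y)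
    [IsIso ((D.pull f).map φ)] : IsIso ((D.pull g).map φ) := by
  subst h; assumption

lemma isIso_pull_comp_map (f : A ⥤ B) (g : B ⥤ C) {X Y : D.diag C} (φ : X ⟶ Y)
    [IsIso ((D.pull g).map φ)] : IsIso ((D.pull (f ⋙ g)).map φ) := by
  rw [pull_map_comp]; infer_instance

end Coherence

lemma eq_of_eqToHom_comp {C : Type*} [Category C] {X X' Y Y' : C} {h : X' = X} {h' : Y = Y'}
    {f : X ⟶ Y} {g : X' ⟶ Y'} (hf : eqToHom h ≫ f ≫ eqToHom h' = g) :
    f = eqToHom h.symm ≫ g ≫ eqToHom h'.symm := by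
  subst h h'; simpa using hf

lemma pt_comp {A B : Type w} [Category.{w} A] [Category.{w} B] (a : A) (u : A ⥤ B) :
    pt a ⋙ u = pt (u.obj a) :=
  CategoryTheory.Functor.ext (fun _ => rfl) (fun _ _ _ => by simp)

instance {A : Type w} [Category.{w} A] (f g : A ⥤ One.{w}) : Subsingleton (f ⟶ g) :=
  ⟨fun _ _ => NatTrans.ext (funext fun _ => Subsingleton.elim _ _)⟩

lemma functor_one_eq {A : Type w} [Category.{w} A] (f g : A ⥤ One.{w}) : f = g :=
  CategoryTheory.Functor.ext (fun _ => Subsingleton.elim _ _) (fun _ _ _ => Subsingleton.elim _ _)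

/-! ### Colimiting cocones -/

section Colimits

variable (D : Prederivator.{w, v, u})
variable {A B C E : Type w} [Category.{w} A] [Category.{w} B] [Category.{w} C] [Category.{w} E]

/-- On diagrams restricted from `𝟙`, all transformations act as structural identities. -/
lemma pull₂_app_pull_one {f g : A ⥤ B} (α : f ⟶ g) (π : B ⥤ One.{w}) (W : D.diag One.{w})
    {Z : D.diag B} (hZ : Z = (D.pull π).obj W) : ∃ h, (D.pull₂ α).app Z = eqToHom h := by
  subst hZ
  have h₀ : f ⋙ π = g ⋙ π := functor_one_eq _ _
  have h := D.pull₂_whiskerRight_app α π W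
  rw [Subsingleton.elim (Functor.whiskerRight α π) (eqToHom h₀), pull₂_eqToHom] at h
  refine ⟨by rw [← pull_comp_obj, ← pull_comp_obj, h₀], ?_⟩
  rw [← cancel_epi (eqToHom (D.pull_comp_obj f π W)),
    ← cancel_mono (eqToHom (D.pull_comp_obj g π W).symm)]
  simp only [Category.assoc]
  rw [← h]
  simp

/-- Finality of right adjoints: maps from `X` to a constant diagram are not changed by restriction
along a right adjoint. -/
lemma pull_map_bijective_of_adjunction {l : A ⥤ B} {r : B ⥤ A} (adj : r ⊣ l) (X : D.diag B)
    (π : B ⥤ One.{w}) (W : D.diag One.{w}) :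
    Function.Bijective fun ψ : X ⟶ (D.pull π).obj W => (D.pull l).map ψ := by
  constructor
  · intro ψ₁ ψ₂ h
    obtain ⟨e, he⟩ := D.pull₂_app_pull_one adj.unit π W rfl
    have key : ∀ ψ : X ⟶ (D.pull π).obj W, (D.pull (𝟭 B)).map ψ =
        (D.pull₂ adj.unit).app X ≫ (D.pull (r ⋙ l)).map ψ ≫ eqToHom e.symm := by
      intro ψ
      have := (D.pull₂ adj.unit).naturality ψ
      rw [he] at this
      rw [← Category.assoc, ← this]
      simp
    have h' : (D.pull (𝟭 B)).map ψ₁ = (D.pull (𝟭 B)).map ψ₂ := by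
      rw [key, key, pull_map_comp, pull_map_comp]
      simp only at h
      rw [h]
    rw [pull_map_id, pull_map_id] at h'
    exact (cancel_mono _).1 ((cancel_epi _).1 h')
  · intro χ
    obtain ⟨e, he⟩ := D.pull₂_app_pull_one adj.counit (l ⋙ π) W (D.pull_comp_obj l π W).symm
    have nat := (D.pull₂ adj.counit).naturality χ
    rw [he, pull_map_id, pull_map_comp] at nat
    -- By the triangle identity, the inverse image of `χ` is its transpose under `l^* ⊣ r^*`.
    have tri : D.pull₂ (Functor.whiskerLeft l adj.unit) ≫
        D.pull₂ (Functor.whiskerRight adj.counit l) = 𝟙 _ := by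
      rw [← pull₂_id, ← pull₂_comp]
      congr 1
      ext x
      simp
    have tri := NatTrans.congr_app tri X
    rw [NatTrans.comp_app, pull₂_whiskerLeft_app, pull₂_whiskerRight_app] at tri
    have hX : X = (D.pull (𝟭 B)).obj X := by rw [pull_id]; rfl
    have hW : (D.pull r).obj ((D.pull l).obj ((D.pull π).obj W)) = (D.pull π).obj W := by
      rw [← pull_comp_obj, ← pull_comp_obj]
      exact D.pull_congr_obj (functor_one_eq _ _) W
    refine ⟨eqToHom hX ≫ (D.pull₂ adj.unit).app X ≫ eqToHom (D.pull_comp_obj r l X) ≫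
      (D.pull r).map χ ≫ eqToHom hW, ?_⟩
    simp only [Functor.map_comp, eqToHom_map]
    have nat' := eq_of_eqToHom_comp (f := (D.pull l).map ((D.pull r).map χ)) (by simpa using nat)
    have hA : (D.pull (l ⋙ 𝟭 B)).obj X = (D.pull (𝟭 A)).obj ((D.pull l).obj X) :=
      D.pull_comp_obj (𝟭 A) l X
    have tri' := eq_of_eqToHom_comp (f := (D.pull l).map ((D.pull₂ adj.unit).app X) ≫
      eqToHom ((D.pull_comp_obj l (r ⋙ l) X).symm.trans (D.pull_comp_obj (l ⋙ r) l X)) ≫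
      (D.pull₂ adj.counit).app ((D.pull l).obj X)) (h := D.pull_comp_obj _ _ _) (h' := hA.symm)
      (g := 𝟙 _) (by simpa using tri)
    simp only [Category.id_comp, eqToHom_trans] at tri'
    rw [nat']
    simp only [Category.assoc, eqToHom_trans_assoc, eqToHom_trans]
    rw [reassoc_of% tri']
    simp

/-- The cocone `α` with vertex `b` exhibits the value `X_b = b^* X` as the colimit of the diagram
`f^* X`: maps `X_b ⟶ W` correspond to maps from `f^* X` to the constant diagram at `W`. The vertex
is a functor `𝟙 ⥤ B`, and the functor `π : C ⥤ 𝟙` (which is unique) is a variable so that the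
transformation of a comma category is an instance. -/
def IsColim (X : D.diag B) {f : C ⥤ B} {π : C ⥤ One.{w}} {b : One.{w} ⥤ B}
    (α : f ⟶ π ⋙ b) : Prop :=
  ∀ W : D.diag One.{w}, Function.Bijective fun φ : (D.pull b).obj X ⟶ W =>
    (D.pull₂ α).app X ≫ eqToHom (D.pull_comp_obj π b X) ≫ (D.pull π).map φ

variable {D}

lemma bijective_comp_comp {C : Type*} [Category C] {X X' Y Y' : C} {S : Type*} (f : S → (X ⟶ Y))
    (a : X' ⟶ X) (b : Y ⟶ Y') [IsIso a] [IsIso b] :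
    Function.Bijective (fun s => a ≫ f s ≫ b) ↔ Function.Bijective f := by
  have : Function.Bijective (fun φ : X ⟶ Y => a ≫ φ ≫ b) :=
    ((asIso a).symm.homCongr (asIso b)).bijective
  exact Function.Bijective.of_comp_iff' this f

lemma isColim_congr [Quiver.IsThin B] {X : D.diag B} {f f' : C ⥤ B} {π π' : C ⥤ One.{w}}
    {b b' : One.{w} ⥤ B} (α : f ⟶ π ⋙ b) (α' : f' ⟶ π' ⋙ b') (hf : f = f') (hb : b = b') :
    D.IsColim X α ↔ D.IsColim X α' := by
  obtain rfl : π = π' := functor_one_eq _ _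
  subst hf hb
  obtain rfl : α = α' := NatTrans.ext (funext fun _ => Subsingleton.elim _ _)
  rfl

lemma isColim_pull_iff {X : D.diag E} (j : B ⥤ E) {f : C ⥤ B} {π : C ⥤ One.{w}}
    {b : One.{w} ⥤ B} (α : f ⟶ π ⋙ b) :
    D.IsColim ((D.pull j).obj X) α ↔
      D.IsColim X (f := f ⋙ j) (b := b ⋙ j) (Functor.whiskerRight α j) := by
  refine forall_congr' fun W => ?_
  have h₁ : Function.Bijective (fun φ : (D.pull b).obj ((D.pull j).obj X) ⟶ W =>
      eqToHom (D.pull_comp_obj b j X) ≫ φ) :=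
    ((eqToIso (D.pull_comp_obj b j X)).symm.homFromEquiv).bijective
  rw [← Function.Bijective.of_comp_iff _ h₁,
    ← bijective_comp_comp _ (eqToHom (D.pull_comp_obj f j X)) (𝟙 _)]
  refine iff_of_eq (congrArg _ (funext fun φ => ?_))
  simp [pull₂_whiskerRight_app, eqToHom_map]

lemma isColim_whiskerLeft_iff {X : D.diag B} {l : E ⥤ C} {r : C ⥤ E} (adj : r ⊣ l) {f : C ⥤ B}
    {π : C ⥤ One.{w}} {b : One.{w} ⥤ B} (α : f ⟶ π ⋙ b) :
    D.IsColim X (f := l ⋙ f) (π := l ⋙ π) (Functor.whiskerLeft l α) ↔ D.IsColim X α := by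
  refine forall_congr' fun W => ?_
  rw [← (D.pull_map_bijective_of_adjunction adj _ π W).of_comp_iff',
    ← bijective_comp_comp _ (eqToHom (D.pull_comp_obj l f X))
      (eqToHom (D.pull_comp_obj l π W).symm)]
  refine iff_of_eq (congrArg _ (funext fun φ => ?_))
  simp [pull₂_whiskerLeft_app, eqToHom_map, pull_map_comp]

variable [D.IsDerivator]

/-- (Der4) for `u_!` in terms of maps into an arbitrary object `W`: the adjunct of the mate is a
bijection. -/
lemma lan_bijective (u : A ⥤ B) (b : One.{w} ⥤ B) (Y : D.diag A) (W : D.diag One.{w}) :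
    Function.Bijective fun φ : (D.pull b).obj ((D.lan u).obj Y) ⟶ W =>
      (D.pull (Comma.fst u b)).map ((D.lanAdj u).unit.app Y) ≫
        eqToHom (D.pull_comp_obj _ _ _).symm ≫
        (D.pull₂ (Comma.natTrans u b)).app ((D.lan u).obj Y) ≫
        eqToHom (D.pull_comp_obj _ _ _) ≫ (D.pull (Comma.snd u b)).map φ := by
  have := IsDerivator.lan_pointwise (D := D) u b
  have h₁ : Function.Bijective (fun φ : (D.pull b).obj ((D.lan u).obj Y) ⟶ W =>
      (D.lanMate (Comma.natTrans u b)).app Y ≫ φ) :=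
    ((asIso ((D.lanMate (Comma.natTrans u b)).app Y)).symm.homFromEquiv).bijective
  have h₂ := ((D.lanAdj (Comma.snd u b)).homEquiv _ W).bijective.comp h₁
  refine (congrArg Function.Bijective (funext fun φ => ?_)).mp h₂
  rw [Function.comp_apply, Adjunction.homEquiv_unit, Functor.map_comp, ← Category.assoc]
  have := unit_mateEquiv_symm (D.lanAdj u) (D.lanAdj (Comma.snd u b))
    (TwoSquare.mk _ _ _ _ (D.pullSquare (Comma.natTrans u b))) Y
  refine (congrArg (· ≫ (D.pull (Comma.snd u b)).map φ) this.symm).trans ?_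
  simp [pullSquare, pullComp_inv_app, pullComp_hom_app]

end Colimits

/-! ### Kan extensions along fully faithful functors -/

section FullyFaithful

variable {D : Prederivator.{w, v, u}} [D.IsDerivator]
variable {A B C E : Type w} [Category.{w} A] [Category.{w} B] [Category.{w} C] [Category.{w} E]

/-- The object `(a, 𝟙)` of the comma category `(u / u a)`. -/
def commaTerminal (u : A ⥤ B) (a : A) : One.{w} ⥤ Comma u (pt a ⋙ u) :=
  pt { left := a, right := ⟨⟨⟩⟩, hom := 𝟙 _ }

/-- For `u` fully faithful, `(a, 𝟙)` is a terminal object of `(u / u a)`. This is stated as an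
adjunction between the functors from and to `𝟙`. -/
noncomputable def commaSndAdj (u : A ⥤ B) [u.Full] [u.Faithful] (a : A) :
    Comma.snd u (pt a ⋙ u) ⊣ commaTerminal u a :=
  Adjunction.mkOfUnitCounit
    { unit :=
        { app := fun x =>
            { left := u.preimage x.hom
              right := eqToHom (Subsingleton.elim _ _)
              w := by simp [commaTerminal] }
          naturality := fun x y f => by
            ext
            · apply u.map_injective
              simp [commaTerminal]
            · exact Subsingleton.elim _ _ }
      counit := { app := fun _ => eqToHom (Subsingleton.elim _ _) }
      left_triangle := Subsingleton.elim _ _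
      right_triangle := by
        ext x
        · apply u.map_injective
          simp [commaTerminal]
        · exact Subsingleton.elim _ _ }

/-- For `u` fully faithful, `u_!` is fully faithful: the comma category `(u / u a)`, over which
`u_!` is computed at `u a`, has the terminal object `(a, 𝟙)`. -/
lemma isIso_lanAdj_unit (u : A ⥤ B) [u.Full] [u.Faithful] : IsIso (D.lanAdj u).unit := by
  rw [NatTrans.isIso_iff_isIso_app]
  refine fun Y => IsDerivator.conservative _ fun a => ?_
  have hα : Functor.whiskerLeft (commaTerminal u a) (Comma.natTrans u (pt a ⋙ u)) =
      eqToHom (show pt a ⋙ u = _ from rfl) := by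
    ext x
    simp [commaTerminal]
  have hα' := congrArg (fun t => (D.pull₂ t).app ((D.lan u).obj Y)) hα
  rw [pull₂_whiskerLeft_app] at hα'
  have hα' := hα'.trans (pull₂_eqToHom D _ _)
  have hα' := eq_of_eqToHom_comp hα'
  have ht : commaTerminal u a ⋙ Comma.snd u (pt a ⋙ u) = 𝟭 _ := functor_one_eq _ _
  have hf : commaTerminal u a ⋙ Comma.fst u (pt a ⋙ u) = pt a := rfl
  have hfst := fun {X Y : D.diag A} (φ : X ⟶ Y) =>
    eq_of_eqToHom_comp (((D.pull_map_congr hf φ).symm.trans (D.pull_map_comp _ _ φ)).symm)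
  have hsnd := fun {X Y : D.diag One.{w}} (φ : X ⟶ Y) =>
    eq_of_eqToHom_comp ((((D.pull_map_congr ht φ).trans (by rw [pull_map_id])).symm.trans
      (D.pull_map_comp _ _ φ)).symm)
  -- Restricted to the terminal object, the bijection of (Der4) is precomposition with the unit at `a`.
  have key : ∀ W, Function.Bijective fun φ : _ ⟶ W =>
      ((D.pull (pt a)).map ((D.lanAdj u).unit.app Y) ≫
        eqToHom (D.pull_comp_obj (pt a) u ((D.lan u).obj Y)).symm) ≫ φ := by
    intro W
    have := (D.pull_map_bijective_of_adjunction (commaSndAdj u a) _ _ W).comp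
      (D.lan_bijective u (pt a ⋙ u) Y W)
    rw [← bijective_comp_comp _ (eqToHom ((D.pull_congr_obj hf Y).symm.trans
        (D.pull_comp_obj (commaTerminal u a) (Comma.fst u (pt a ⋙ u)) Y)))
      (eqToHom (show _ = W by rw [← pull_comp_obj, ht, pull_id]; rfl))] at this
    refine (congrArg Function.Bijective (funext fun φ => ?_)).mp this
    simp only [Function.comp_apply, Functor.map_comp, eqToHom_map, hfst, hsnd, hα']
    simp
  have := isIso_of_coyoneda_map_bijective _ key
  exact IsIso.of_isIso_comp_right _ (eqToHom (D.pull_comp_obj (pt a) u ((D.lan u).obj Y)).symm)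

/-- The value of `X` at `b` is the colimit of `u^* X` over `(u / b)` exactly if the counit
`u_! u^* X ⟶ X` is invertible at `b`. -/
lemma isColim_comma_iff (u : A ⥤ B) (b : One.{w} ⥤ B) (X : D.diag B) :
    D.IsColim X (Comma.natTrans u b) ↔
      IsIso ((D.pull b).map ((D.lanAdj u).counit.app X)) := by
  have key : ∀ W, Function.Bijective (fun φ : (D.pull b).obj X ⟶ W =>
      (D.pull₂ (Comma.natTrans u b)).app X ≫ eqToHom (D.pull_comp_obj (Comma.snd u b) b X) ≫
        (D.pull (Comma.snd u b)).map φ) ↔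
      Function.Bijective (fun φ : (D.pull b).obj X ⟶ W =>
        (D.pull b).map ((D.lanAdj u).counit.app X) ≫ φ) := by
    -- Precomposition with the counit at `b`, followed by the bijection of (Der4) for `u^* X`, is the
    -- map in question, by a triangle identity.
    intro W
    rw [← (D.lan_bijective u b ((D.pull u).obj X) W).of_comp_iff',
      ← bijective_comp_comp _ (eqToHom (D.pull_comp_obj (Comma.fst u b) u X).symm) (𝟙 _)]
    refine iff_of_eq (congrArg _ (funext fun φ => ?_))
    have nat := (D.pull₂ (Comma.natTrans u b)).naturality ((D.lanAdj u).counit.app X)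
    rw [pull_map_comp, pull_map_comp] at nat
    have tri := congrArg (D.pull (Comma.fst u b)).map
      ((D.lanAdj u).right_triangle_components X)
    rw [CategoryTheory.Functor.map_comp, CategoryTheory.Functor.map_id] at tri
    have nat' := congrArg (fun t => t ≫ eqToHom (D.pull_comp_obj (Comma.snd u b) b X)) nat
    simp only [Category.assoc, eqToHom_trans, eqToHom_refl, Category.comp_id] at nat'
    simp only [Function.comp_apply, Functor.map_comp]
    rw [← reassoc_of% nat']
    simp [reassoc_of% tri]
  constructor
  · intro h
    exact isIso_of_coyoneda_map_bijective _ fun W => (key W).1 (h W)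
  · intro h W
    exact (key W).2 (isIso_iff_coyoneda_map_bijective _ |>.1 h W)

/-- Left Kan extensions along fully faithful functors are pointwise colimits of their restrictions. -/
lemma isColim_of_mem_essImage (u : A ⥤ B) [u.Full] [u.Faithful] {X : D.diag B}
    (hX : (D.lan u).essImage X) (b : One.{w} ⥤ B) : D.IsColim X (Comma.natTrans u b) := by
  have := D.isIso_lanAdj_unit u
  have := (D.lanAdj u).fullyFaithfulLOfIsIsoUnit.full
  have := (D.lanAdj u).fullyFaithfulLOfIsIsoUnit.faithful
  have := (D.lanAdj u).isIso_counit_app_iff_mem_essImage.2 hX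
  rw [isColim_comma_iff]
  infer_instance

/-- A diagram is a left Kan extension along a fully faithful functor if its values outside of the
image are pointwise colimits. -/
lemma isIso_lanAdj_counit_app (u : A ⥤ B) [u.Full] [u.Faithful] (X : D.diag B)
    (h : ∀ b, (∃ a, u.obj a = b) ∨ D.IsColim X (Comma.natTrans u (pt b))) :
    IsIso ((D.lanAdj u).counit.app X) := by
  refine IsDerivator.conservative _ fun b => ?_
  rcases h b with ⟨a, rfl⟩ | h
  · have := D.isIso_lanAdj_unit u
    have : IsIso ((D.pull u).map ((D.lanAdj u).counit.app X)) := by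
      have h := (D.lanAdj u).right_triangle_components X
      have : IsIso (𝟙 ((D.pull u).obj X)) := inferInstance
      exact IsIso.of_isIso_fac_left h
    have := D.isIso_pull_comp_map (pt a) u ((D.lanAdj u).counit.app X)
    exact D.isIso_pull_map_of_eq (pt_comp a u) _
  · exact (isColim_comma_iff u _ X).1 h

lemma isIso_ranAdj_counit (u : A ⥤ B) [u.Full] [u.Faithful] : IsIso (D.ranAdj u).counit :=
  (Adjunction.Triple.mk (D.lanAdj u) (D.ranAdj u)).isIso_unit_iff_isIso_counit.1
    (isIso_lanAdj_unit u)

/-- By (Der1) for the empty family, `D(∅)` is equivalent to `𝟙`, so that all its sets of morphisms are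
singletons. -/
lemma nonempty_unique_hom_of_isEmpty [IsEmpty A] (X Y : D.diag A) :
    Nonempty (Unique (X ⟶ Y)) := by
  let S := Σ _ : PEmpty.{w + 1}, One.{w}
  let f : A ⥤ S := functorOfIsEmpty A S
  let g : S ⥤ A := functorOfIsEmpty S A
  have hfg : f ⋙ g = 𝟭 A := CategoryTheory.Functor.ext isEmptyElim (fun x => isEmptyElim x)
  have hobj : ∀ Z : D.diag A, Z = (D.pull f).obj ((D.pull g).obj Z) := fun Z => by
    rw [← pull_comp_obj, hfg, pull_id]; rfl
  have inj : ∀ φ ψ : X ⟶ Y, (D.pull g).map φ = (D.pull g).map ψ → φ = ψ := fun φ ψ h => by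
    have h' : (D.pull (f ⋙ g)).map φ = (D.pull (f ⋙ g)).map ψ := by
      rw [pull_map_comp, pull_map_comp, h]
    rw [pull_map_congr D hfg φ, pull_map_congr D hfg ψ, pull_map_id, pull_map_id] at h'
    have h' := (cancel_mono _).1 ((cancel_epi _).1 h')
    exact (cancel_mono _).1 ((cancel_epi _).1 h')
  let F := Functor.pi' fun i : PEmpty.{w + 1} => D.pull (Sigma.incl (C := fun _ => One.{w}) i)
  have hF : F.IsEquivalence := IsDerivator.coprod PEmpty.{w + 1} fun _ => One.{w}
  exact ⟨{ default := eqToHom (hobj X) ≫ (D.pull f).map (F.preimage fun i => i.elim) ≫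
             eqToHom (hobj Y).symm
           uniq := fun _ => inj _ _ (F.map_injective (funext fun i => i.elim)) }⟩

/-- `u_*` is extension by terminal objects at all `b` that map to no object of the image of `u`. -/
lemma isTerminal_pull_ran (u : A ⥤ B) (b : B) (h : ∀ a, IsEmpty (b ⟶ u.obj a)) (Y : D.diag A) :
    Nonempty (Limits.IsTerminal ((D.pull (pt b)).obj ((D.ran u).obj Y))) := by
  have := IsDerivator.ran_pointwise (D := D) (pt b) u
  have : IsEmpty (Comma (pt.{w} b) u) := ⟨fun x => (h x.right).elim x.hom⟩
  refine ⟨Limits.IsTerminal.ofIso ?_ (asIso ((D.ranMate (Comma.natTrans (pt b) u)).app Y)).symm⟩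
  let e := fun X => (((D.ranAdj (Comma.fst (pt b) u)).homEquiv X
    ((D.pull (Comma.snd (pt b) u)).obj Y)))
  have hu := fun X => nonempty_unique_hom_of_isEmpty (D := D)
    ((D.pull (Comma.fst (pt b) u)).obj X) ((D.pull (Comma.snd (pt b) u)).obj Y)
  exact Limits.IsTerminal.ofUniqueHom (fun X => e X (hu X).some.default)
    (fun X m => (e X).symm.injective (((hu X).some.uniq _).trans (by simp)))

/-- A diagram is a right Kan extension along the inclusion of a sieve if its values outside of the
sieve are terminal. -/
lemma isIso_ranAdj_unit_app (u : A ⥤ B) [u.Full] [u.Faithful] (X : D.diag B)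
    (h : ∀ b, (∃ a, u.obj a = b) ∨ ((∀ a, IsEmpty (b ⟶ u.obj a)) ∧
      Nonempty (Limits.IsTerminal ((D.pull (pt b)).obj X)))) :
    IsIso ((D.ranAdj u).unit.app X) := by
  refine IsDerivator.conservative _ fun b => ?_
  rcases h b with ⟨a, rfl⟩ | ⟨h, ⟨t⟩⟩
  · have := D.isIso_ranAdj_counit u
    have : IsIso ((D.pull u).map ((D.ranAdj u).unit.app X)) := by
      have h := (D.ranAdj u).left_triangle_components X
      have : IsIso (𝟙 ((D.pull u).obj X)) := inferInstance
      exact IsIso.of_isIso_fac_right h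
    have := D.isIso_pull_comp_map (pt a) u ((D.ranAdj u).unit.app X)
    exact D.isIso_pull_map_of_eq (pt_comp a u) _
  · obtain ⟨t'⟩ := isTerminal_pull_ran u b h ((D.pull u).obj X)
    exact Limits.isIso_of_isTerminal t t' _

end FullyFaithful

/-! ### Pointwise colimits in thin categories -/

section ThinFinality

variable {A B C Q P : Type w} [Category.{w} A] [Category.{w} B] [Category.{w} C] [Category.{w} Q]
  [Category.{w} P]

instance (u : A ⥤ B) (b : One.{w} ⥤ B) [Quiver.IsThin A] : Quiver.IsThin (Comma u b) :=
  fun _ _ => ⟨fun _ _ => CommaMorphism.ext (Subsingleton.elim _ _) (Subsingleton.elim _ _)⟩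

/-- The functor `C ⥤ (u / b)`, `c ↦ f c`, for `b` above all objects `u (f c)`. -/
def toComma [Quiver.IsThin B] (f : C ⥤ A) (u : A ⥤ B) (b : B) (h : ∀ c, u.obj (f.obj c) ⟶ b) :
    C ⥤ Comma u (pt.{w} b) where
  obj c := { left := f.obj c, right := ⟨⟨⟩⟩, hom := h c }
  map g := { left := f.map g, right := 𝟙 _, w := Subsingleton.elim (α := _ ⟶ b) _ _ }

/-- In thin categories, `C ⥤ (u / b)` is a right adjoint as soon as each `a` with `u a ⟶ b` has a
least `c₀` in `C` with `a ⟶ f c₀`. -/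
lemma isRightAdjoint_toComma [Quiver.IsThin A] [Quiver.IsThin B] [Quiver.IsThin C] (f : C ⥤ A)
    (u : A ⥤ B) (b : B) (h : ∀ c, u.obj (f.obj c) ⟶ b)
    (h' : ∀ a, (u.obj a ⟶ b) → ∃ c₀, ∀ c, Nonempty (c₀ ⟶ c) ↔ Nonempty (a ⟶ f.obj c)) :
    (toComma f u b h).IsRightAdjoint := by
  choose r hr using h'
  refine (Adjunction.adjunctionOfEquivLeft (G := toComma f u b h)
    (F_obj := fun x => r x.left x.hom) (fun x c =>
      { toFun := fun g =>
          { left := ((hr x.left x.hom c).1 ⟨g⟩).some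
            right := eqToHom (Subsingleton.elim _ _)
            w := Subsingleton.elim (α := _ ⟶ b) _ _ }
        invFun := fun g => ((hr x.left x.hom c).2 ⟨g.left⟩).some
        left_inv := fun _ => Subsingleton.elim _ _
        right_inv := fun _ => Subsingleton.elim _ _ })
      fun _ _ _ _ _ => Subsingleton.elim _ _).isRightAdjoint

variable {D : Prederivator.{w, v, u}}

lemma isColim_comma_iff_of_thin [Quiver.IsThin A] [Quiver.IsThin B] [Quiver.IsThin C]
    (f : C ⥤ A) (u : A ⥤ B) (b : B) (h : ∀ c, u.obj (f.obj c) ⟶ b)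
    (h' : ∀ a, (u.obj a ⟶ b) → ∃ c₀, ∀ c, Nonempty (c₀ ⟶ c) ↔ Nonempty (a ⟶ f.obj c))
    (X : D.diag B) {π : C ⥤ One.{w}} (α : f ⋙ u ⟶ π ⋙ pt b) :
    D.IsColim X (Comma.natTrans u (pt b)) ↔ D.IsColim X α := by
  have := isRightAdjoint_toComma f u b h h'
  rw [← isColim_whiskerLeft_iff (Adjunction.ofIsRightAdjoint (toComma f u b h))
    (Comma.natTrans u (pt b))]
  exact isColim_congr _ _ rfl rfl

variable [D.IsDerivator]

/-- Detection of pointwise Kan extensions: if `X` is a left Kan extension along `k`, then the value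
of `j^* X` at `b` is a colimit over `(u / b)`, provided that a category `C` maps by right adjoints,
hence finally, both to `(u / b)` and to `(k / j b)`. -/
lemma isColim_pull_of_mem_essImage_lan [Quiver.IsThin A] [Quiver.IsThin B] [Quiver.IsThin C]
    [Quiver.IsThin Q] [Quiver.IsThin P] (k : Q ⥤ P) [k.Full] [k.Faithful] (j : B ⥤ P) (u : A ⥤ B)
    (f : C ⥤ A) (l : C ⥤ Q) (hl : l ⋙ k = f ⋙ u ⋙ j) (b : B)
    (h : ∀ c, u.obj (f.obj c) ⟶ b)
    (hA : ∀ a, (u.obj a ⟶ b) → ∃ c₀, ∀ c, Nonempty (c₀ ⟶ c) ↔ Nonempty (a ⟶ f.obj c))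
    (hQ : ∀ q, (k.obj q ⟶ j.obj b) → ∃ c₀, ∀ c, Nonempty (c₀ ⟶ c) ↔ Nonempty (q ⟶ l.obj c))
    {X : D.diag P} (hX : (D.lan k).essImage X) :
    D.IsColim ((D.pull j).obj X) (Comma.natTrans u (pt b)) := by
  let α : f ⋙ u ⟶ (Functor.const C).obj ⟨⟨⟩⟩ ⋙ pt.{w} b :=
    { app := h, naturality := fun _ _ _ => Subsingleton.elim (α := _ ⟶ b) _ _ }
  rw [isColim_comma_iff_of_thin f u b h hA _ α, isColim_pull_iff]
  let β : l ⋙ k ⟶ (Functor.const C).obj ⟨⟨⟩⟩ ⋙ pt.{w} (j.obj b) :=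
    eqToHom hl ≫ Functor.whiskerRight α j ≫ eqToHom (by rw [← pt_comp]; rfl)
  rw [isColim_congr _ β hl.symm (pt_comp b j), ← isColim_comma_iff_of_thin l k (j.obj b)
    (fun c => β.app c) hQ]
  exact isColim_of_mem_essImage k hX _

end ThinFinality

/-! ### Iterated Kan extensions -/

section Kan

variable {D : Prederivator.{w, v, u}} [D.HasKanExtensions]
variable {A B C : Type w} [Category.{w} A] [Category.{w} B] [Category.{w} C]

lemma essImage_lan_of_comp (f : A ⥤ B) (g : B ⥤ C) {X : D.diag C}
    (hX : (D.lan (f ⋙ g)).essImage X) :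
    (D.lan g).essImage X := by
  obtain ⟨Y, ⟨e⟩⟩ := hX
  let adj := ((D.lanAdj f).comp (D.lanAdj g)).ofNatIsoRight (D.pullComp f g).symm
  exact ⟨(D.lan f).obj Y, ⟨(adj.leftAdjointUniq (D.lanAdj (f ⋙ g))).app Y ≪≫ e⟩⟩

/-- A functor whose values are left Kan extensions along `g` of right Kan extensions along `f` is
recovered from its restriction along `f ⋙ g`. -/
noncomputable def isoRanLan {T : Type*} [Category* T] (F : T ⥤ D.diag C) (f : A ⥤ B) (g : B ⥤ C)
    (hg : ∀ t, IsIso ((D.lanAdj g).counit.app (F.obj t)))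
    (hf : ∀ t, IsIso ((D.ranAdj f).unit.app ((D.pull g).obj (F.obj t)))) :
    F ≅ (F ⋙ D.pull g ⋙ D.pull f) ⋙ D.ran f ⋙ D.lan g :=
  haveI : IsIso (Functor.whiskerLeft F (D.lanAdj g).counit) :=
    (NatTrans.isIso_iff_isIso_app _).2 hg
  haveI : IsIso (Functor.whiskerLeft (F ⋙ D.pull g) (D.ranAdj f).unit) :=
    (NatTrans.isIso_iff_isIso_app _).2 hf
  (asIso (Functor.whiskerLeft F (D.lanAdj g).counit)).symm ≪≫
    Functor.isoWhiskerRight (asIso (Functor.whiskerLeft (F ⋙ D.pull g) (D.ranAdj f).unit)) (D.lan g)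

end Kan

/-! ### The grid and its pushout squares -/

section Thin

instance {A B : Type w} [Category.{w} A] [Category.{w} B] [Quiver.IsThin A] [Quiver.IsThin B] :
    Quiver.IsThin (A × B) :=
  fun _ _ => ⟨fun _ _ => Prod.ext (Subsingleton.elim _ _) (Subsingleton.elim _ _)⟩

instance : Quiver.IsThin Corner.{w} :=
  fun _ _ => ⟨fun _ _ => ObjectProperty.hom_ext _ (Subsingleton.elim _ _)⟩

instance : Quiver.IsThin One.{w} := fun _ _ => inferInstance

lemma faithful_of_isThin {A B : Type w} [Category.{w} A] [Category.{w} B] [Quiver.IsThin A]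
    (u : A ⥤ B) : u.Faithful := ⟨fun _ => Subsingleton.elim _ _⟩

lemma full_of_isThin {A B : Type w} [Category.{w} A] [Category.{w} B] [Quiver.IsThin B]
    (u : A ⥤ B) (h : ∀ a a', (u.obj a ⟶ u.obj a') → Nonempty (a ⟶ a')) : u.Full :=
  ⟨fun f => ⟨(h _ _ f).some, Subsingleton.elim _ _⟩⟩

lemma functor_ext_of_isThin {A B : Type w} [Category.{w} A] [Category.{w} B] [Quiver.IsThin B]
    {f g : A ⥤ B} (h : ∀ a, f.obj a = g.obj a) : f = g :=
  CategoryTheory.Functor.ext h fun _ _ _ => Subsingleton.elim _ _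

lemma nonempty_hom_prod_iff {A B : Type w} [Category.{w} A] [Category.{w} B] (x y : A × B) :
    Nonempty (x ⟶ y) ↔ Nonempty (x.1 ⟶ y.1) ∧ Nonempty (x.2 ⟶ y.2) :=
  ⟨fun ⟨f⟩ => ⟨⟨f.1⟩, ⟨f.2⟩⟩, fun ⟨⟨f⟩, ⟨g⟩⟩ => ⟨Prod.mkHom f g⟩⟩

lemma nonempty_hom_iff_le {A : Type w} [Preorder A] (x y : A) : Nonempty (x ⟶ y) ↔ x ≤ y :=
  ⟨fun ⟨f⟩ => leOfHom f, fun h => ⟨homOfLE h⟩⟩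

lemma nonempty_hom_corner_iff (x y : Corner.{w}) : Nonempty (x ⟶ y) ↔ Nonempty (x.obj ⟶ y.obj) :=
  ⟨fun ⟨f⟩ => ⟨f.hom⟩, fun ⟨f⟩ => ⟨ObjectProperty.homMk f⟩⟩

/-- The object of `⌜` with the coordinates `c`. -/
abbrev Corner.mk (c : Fin 2 × Fin 2) (h : c ≠ (1, 1)) : Corner.{w} :=
  ⟨(⟨c.1⟩, ⟨c.2⟩), fun h' => h (Prod.ext (congrArg (·.1.down) h') (congrArg (·.2.down) h'))⟩

/-- The coordinates of an object of `⌜`. -/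
abbrev Corner.val (c : Corner.{w}) : Fin 2 × Fin 2 := (c.obj.1.down, c.obj.2.down)

lemma Corner.val_ne (c : Corner.{w}) : c.val ≠ (1, 1) := fun h =>
  c.property (Prod.ext (ULift.ext _ _ (congrArg Prod.fst h)) (ULift.ext _ _ (congrArg Prod.snd h)))

lemma Corner.nonempty_hom_iff (x y : Corner.{w}) : Nonempty (x ⟶ y) ↔ x.val ≤ y.val := by
  rw [nonempty_hom_corner_iff, nonempty_hom_prod_iff, nonempty_hom_iff_le, nonempty_hom_iff_le]
  rfl

/-- The poset `{0, 1, 2} × {0, 1, 2}`, lifted to the universe `w`. -/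
abbrev Grid : Type w := ULift.{w} (Fin 3 × Fin 3)

/-- The full subposet of the grid on the set `s`. -/
abbrev Region (s : Finset (Fin 3 × Fin 3)) : Type w := {p : Grid.{w} // p.down ∈ s}

/-- The inclusion of a subposet into the grid. -/
abbrev Region.incl (s : Finset (Fin 3 × Fin 3)) : Region.{w} s ⥤ Grid.{w} :=
  (Subtype.mono_coe fun p : Grid.{w} => p.down ∈ s).functor

instance (s : Finset (Fin 3 × Fin 3)) : (Region.incl.{w} s).Faithful := faithful_of_isThin _

instance (s : Finset (Fin 3 × Fin 3)) : (Region.incl.{w} s).Full :=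
  full_of_isThin _ fun _ _ f => ⟨homOfLE (leOfHom f)⟩

/-- The functor `□ ⥤ Grid` given by a monotone map. -/
abbrev Square.toGrid (g : Fin 2 × Fin 2 →o Fin 3 × Fin 3) : Square.{w} ⥤ Grid.{w} where
  obj x := ⟨g (x.1.down, x.2.down)⟩
  map {x y} f := homOfLE (show (_ : Fin 3 × Fin 3) ≤ _ from g.monotone
    ⟨show (x.1 : Two) ≤ y.1 from leOfHom f.1, show (x.2 : Two) ≤ y.2 from leOfHom f.2⟩)

/-- The functor `𝟚 × □ ⥤ Grid` given by a monotone map. -/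
abbrev Prism.toGrid (g : Fin 2 × Fin 2 × Fin 2 →o Fin 3 × Fin 3) :
    Two.{w} × Square.{w} ⥤ Grid.{w} where
  obj x := ⟨g (x.1.down, x.2.1.down, x.2.2.down)⟩
  map {x y} f := homOfLE (show (_ : Fin 3 × Fin 3) ≤ _ from g.monotone
    ⟨show (x.1 : Two) ≤ y.1 from leOfHom f.1, show (x.2.1 : Two) ≤ y.2.1 from leOfHom f.2.1,
      show (x.2.2 : Two) ≤ y.2.2 from leOfHom f.2.2⟩)

/-- The square at `t` of a prism `𝟚 × □ ⥤ Grid`. -/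
abbrev Prism.slice (g : Fin 2 × Fin 2 × Fin 2 →o Fin 3 × Fin 3) (t : Fin 2) :
    Fin 2 × Fin 2 →o Fin 3 × Fin 3 :=
  ⟨fun x => g (t, x), fun _ _ h => g.monotone ⟨le_rfl, h⟩⟩

/-- The corner of the square `g` lies in `s`, and its inclusion into the part of `s` below `g (1, 1)`
has a left adjoint. Diagrams that are left Kan extended from `s` are then cocartesian on this square. -/
def IsPushoutShape (s : Finset (Fin 3 × Fin 3)) (g : Fin 2 × Fin 2 →o Fin 3 × Fin 3) : Prop :=
  (∀ c, c ≠ (1, 1) → g c ∈ s) ∧ ∀ q ∈ s, q ≤ g (1, 1) →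
    ∃ c₀ : Fin 2 × Fin 2, c₀ ≠ (1, 1) ∧ ∀ c, c ≠ (1, 1) → (c₀ ≤ c ↔ q ≤ g c)

/-- The corner of a square whose corner lies in `s`, as a functor to `s`. -/
abbrev Corner.toRegion {s : Finset (Fin 3 × Fin 3)} {g : Fin 2 × Fin 2 →o Fin 3 × Fin 3}
    (h : IsPushoutShape s g) : Corner.{w} ⥤ Region.{w} s where
  obj c := ⟨⟨g c.val⟩, h.1 _ c.val_ne⟩
  map {x y} f := homOfLE (show (_ : Fin 3 × Fin 3) ≤ _ from
    g.monotone ((Corner.nonempty_hom_iff x y).1 ⟨f⟩))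

lemma IsPushoutShape.exists_hom_iff {s : Finset (Fin 3 × Fin 3)}
    {g : Fin 2 × Fin 2 →o Fin 3 × Fin 3} (h : IsPushoutShape s g) (q : Region.{w} s)
    (hq : q.1 ≤ ⟨g (1, 1)⟩) : ∃ c₀ : Corner.{w}, ∀ c : Corner.{w},
      Nonempty (c₀ ⟶ c) ↔ Nonempty (q ⟶ (Corner.toRegion h).obj c) := by
  obtain ⟨c₀, h₀, h₁⟩ := h.2 q.1.down q.2 hq
  refine ⟨Corner.mk c₀ h₀, fun c => ?_⟩
  rw [Corner.nonempty_hom_iff, nonempty_hom_iff_le]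
  exact h₁ c.val c.val_ne

lemma Square.eq_or_corner (x : Square.{w}) : x = (⟨1⟩, ⟨1⟩) ∨ ∃ c, Corner.incl.{w}.obj c = x := by
  by_cases h : x = (⟨1⟩, ⟨1⟩)
  · exact Or.inl h
  · exact Or.inr ⟨⟨x, h⟩, rfl⟩

lemma Corner.hom_corner (c : Corner.{w}) : Nonempty (c.obj ⟶ ((⟨1⟩, ⟨1⟩) : Square.{w})) := by
  rw [nonempty_hom_prod_iff, nonempty_hom_iff_le, nonempty_hom_iff_le]
  exact ⟨Fin.le_last c.obj.1.down, Fin.le_last c.obj.2.down⟩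

instance : ((𝟭 Two.{w}).prod Corner.incl.{w}).Faithful := faithful_of_isThin _

instance : ((𝟭 Two.{w}).prod Corner.incl.{w}).Full :=
  full_of_isThin _ fun _ _ f => ⟨Prod.mkHom f.1 (ObjectProperty.homMk f.2)⟩

instance : ((𝟭 Two.{w}).prod (pt Corner.zero.{w})).Faithful := faithful_of_isThin _

instance : ((𝟭 Two.{w}).prod (pt Corner.zero.{w})).Full :=
  full_of_isThin _ fun _ _ f => ⟨Prod.mkHom f.1 (eqToHom (Subsingleton.elim _ _))⟩

instance : Corner.row.{w}.Faithful := faithful_of_isThin _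

instance : Corner.row.{w}.Full := full_of_isThin _ fun _ _ f => ⟨f.hom.2⟩

variable {D : Prederivator.{w, v, u}} [D.IsDerivator]

/-- Left Kan extensions from `s` are cocartesian on pushout shapes for `s`. -/
lemma isIso_counit_square {s : Finset (Fin 3 × Fin 3)} {g : Fin 2 × Fin 2 →o Fin 3 × Fin 3}
    (h : IsPushoutShape s g) {X : D.diag Grid.{w}} (hX : (D.lan (Region.incl s)).essImage X) :
    IsIso ((D.lanAdj Corner.incl.{w}).counit.app ((D.pull (Square.toGrid g)).obj X)) := by
  refine isIso_lanAdj_counit_app _ _ fun x => (Square.eq_or_corner x).symm.imp_right ?_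
  rintro rfl
  exact isColim_pull_of_mem_essImage_lan (Region.incl.{w} s) (Square.toGrid g) Corner.incl (𝟭 _)
    (Corner.toRegion.{w} h) (functor_ext_of_isThin fun _ => rfl) _ (fun c => c.hom_corner.some)
    (fun a _ => ⟨a, fun _ => Iff.rfl⟩) (fun q f => h.exists_hom_iff q (leOfHom f)) hX

/-- Left Kan extensions from `s` are cocartesian squares in the shifted derivator on prisms with
pushout shapes as both ends. -/
lemma isIso_counit_prism {s : Finset (Fin 3 × Fin 3)} {g : Fin 2 × Fin 2 × Fin 2 →o Fin 3 × Fin 3}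
    (h : ∀ t, IsPushoutShape s (Prism.slice g t)) {X : D.diag Grid.{w}}
    (hX : (D.lan (Region.incl s)).essImage X) :
    IsIso ((D.lanAdj ((𝟭 Two.{w}).prod Corner.incl.{w})).counit.app
      ((D.pull (Prism.toGrid g)).obj X)) := by
  refine isIso_lanAdj_counit_app _ _ fun ⟨t, x⟩ => (Square.eq_or_corner x).symm.imp ?_ ?_
  · rintro ⟨c, rfl⟩
    exact ⟨(t, c), rfl⟩
  · rintro rfl
    -- The corner at `t` is final in the objects of `𝟚 × ⌜` below `(t, (1, 1))`.
    refine isColim_pull_of_mem_essImage_lan (Region.incl.{w} s) (Prism.toGrid.{w} g)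
      ((𝟭 Two.{w}).prod Corner.incl.{w}) (CategoryTheory.Prod.sectR t Corner.{w})
      (Corner.toRegion.{w} (h t.down)) (functor_ext_of_isThin fun _ => rfl) (t, _)
      (fun c => Prod.mkHom (𝟙 t) c.hom_corner.some) (fun a f => ⟨a.2, fun c => ?_⟩)
      (fun q f => (h t.down).exists_hom_iff q (leOfHom f)) hX
    rw [nonempty_hom_prod_iff]
    exact (and_iff_right ⟨f.1⟩).symm

end Thin

/-! ### The iterated cofiber diagram -/

section CoherentDiagram

set_option synthInstance.maxSize 1000 in
instance (s : Finset (Fin 3 × Fin 3)) (g : Fin 2 × Fin 2 →o Fin 3 × Fin 3) :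
    Decidable (IsPushoutShape s g) := by
  unfold IsPushoutShape
  infer_instance

/-- The part of the grid on which the diagram of iterated cofibers is prescribed: `x ⟶ y` at
`(0, 0)` and `(0, 1)`, and zero objects at `(0, 2)`, `(1, 0)`, `(2, 0)` and `(2, 1)`. -/
abbrev baseRegion : Finset (Fin 3 × Fin 3) := {(1, 1), (1, 2), (2, 2)}ᶜ

/-- The inclusion of the arrow `(0, 0) ⟶ (0, 1)`. -/
abbrev baseRow : Two.{w} ⥤ Region.{w} baseRegion where
  obj i := ⟨⟨(0, i.down.castSucc)⟩, by revert i; rintro ⟨i⟩; revert i; decide⟩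
  map {x y} f := homOfLE (show (_ : Fin 3 × Fin 3) ≤ _ from
    ⟨le_rfl, show (x : Two) ≤ y from leOfHom f⟩)

instance : baseRow.{w}.Faithful := faithful_of_isThin _

instance : baseRow.{w}.Full := full_of_isThin _ fun x y f =>
  ⟨homOfLE (show (x : Two) ≤ y from (show (_ : Grid) ≤ _ from leOfHom f).2)⟩

/-- The square with objects `x`, `y`, `0` and `cof f`. -/
def square₁ : Fin 2 × Fin 2 →o Fin 3 × Fin 3 := ⟨fun x => (x.1.castSucc, x.2.castSucc), by decide⟩

/-- The square with objects `y`, `cof f`, `0` and `Σ x`. It is transposed, as the cofiber functor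
places the given morphism at the first coordinate `0` and the zero object at `(1, 0)`. -/
def square₂ : Fin 2 × Fin 2 →o Fin 3 × Fin 3 := ⟨fun x => (x.2.castSucc, x.1.succ), by decide⟩

/-- The square with objects `cof f`, `Σ x`, `0` and `Σ y`. -/
def square₃ : Fin 2 × Fin 2 →o Fin 3 × Fin 3 := ⟨fun x => (x.1.succ, x.2.succ), by decide⟩

/-- The squares with objects `x`, `0`, `0`, `Σ x` and with objects `y`, `0`, `0`, `Σ y`, and the map
from the former to the latter. -/
def prism : Fin 2 × Fin 2 × Fin 2 →o Fin 3 × Fin 3 :=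
  ⟨fun x => (![x.2.1.castSucc, ![0, 2] x.2.1] x.1, ![![0, 2] x.2.2, x.2.2.succ] x.1), by decide⟩

lemma isPushoutShape_square₁ : IsPushoutShape baseRegion square₁ := by decide
lemma isPushoutShape_square₂ : IsPushoutShape {(1, 2), (2, 2)}ᶜ square₂ := by decide
lemma isPushoutShape_square₃ : IsPushoutShape {(2, 2)}ᶜ square₃ := by decide
lemma isPushoutShape_prism (t : Fin 2) : IsPushoutShape baseRegion (Prism.slice prism t) := by
  revert t; decide

variable (D : Prederivator.{w, v, u}) [D.IsDerivator]

/-- The diagram on the grid obtained from `f : x ⟶ y` by inserting zero objects and then pushouts.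
Its rows are `x ⟶ y ⟶ 0`, `0 ⟶ cof f ⟶ Σ x` and `0 ⟶ 0 ⟶ Σ y`. -/
noncomputable def gridDiag : D.diag Two.{w} ⥤ D.diag Grid.{w} :=
  D.ran baseRow ⋙ D.lan (Region.incl baseRegion)

/-- As left Kan extensions compose, the grid diagram is left Kan extended from every region that
contains the base region. -/
lemma gridDiag_mem_essImage {s : Finset (Fin 3 × Fin 3)} (h : baseRegion ⊆ s) (X : D.diag Two.{w}) :
    (D.lan (Region.incl s)).essImage (D.gridDiag.obj X) := by
  let f : Region.{w} baseRegion ⥤ Region.{w} s :=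
    { obj := fun p => ⟨p.1, h p.2⟩
      map := fun g => homOfLE (show (_ : Grid) ≤ _ from leOfHom g) }
  refine essImage_lan_of_comp f (Region.incl s) ?_
  exact (D.lan (Region.incl baseRegion)).obj_mem_essImage _

/-- At the vertices of the base region outside of the given arrow, the grid diagram is zero. This is
used in the form that its values there are terminal objects. -/
lemma isTerminal_gridDiag (X : D.diag Two.{w}) (p : Fin 3 × Fin 3) (hp : p ∈ baseRegion)
    (hp' : ¬ p ≤ (0, 1)) :
    Nonempty (Limits.IsTerminal ((D.pull (pt (⟨p⟩ : Grid.{w}))).obj (D.gridDiag.obj X))) := by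
  have hrow : ∀ i : Fin 2, ((0, i.castSucc) : Fin 3 × Fin 3) ≤ (0, 1) := by decide
  obtain ⟨t⟩ := isTerminal_pull_ran (D := D) baseRow ⟨⟨p⟩, hp⟩ (fun i => ⟨fun f =>
    hp' (le_trans (show (_ : Grid) ≤ _ from leOfHom f) (hrow i.down))⟩) X
  have := D.isIso_lanAdj_unit (Region.incl.{w} baseRegion)
  refine ⟨t.ofIso ((D.pull (pt _)).mapIso
    (asIso ((D.lanAdj (Region.incl.{w} baseRegion)).unit.app _)) ≪≫ eqToIso ?_)⟩
  exact (D.pull_comp_obj _ _ _).symm.trans (D.pull_congr_obj (pt_comp _ _) _)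

/-- The grid diagram extends the given morphism. -/
noncomputable def gridDiagPullIso : D.gridDiag ⋙ D.pull (baseRow ⋙ Region.incl baseRegion) ≅ 𝟭 _ :=
  haveI := D.isIso_lanAdj_unit (Region.incl.{w} baseRegion)
  haveI := D.isIso_ranAdj_counit baseRow.{w}
  Functor.isoWhiskerLeft D.gridDiag (D.pullComp _ _) ≪≫
    Functor.isoWhiskerRight (Functor.isoWhiskerLeft (D.ran baseRow)
      (asIso (D.lanAdj (Region.incl.{w} baseRegion)).unit).symm) (D.pull baseRow) ≪≫
    asIso (D.ranAdj baseRow).counit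

/-- The corner of a square is extended by zero if the object at `(1, 0)` is prescribed to be zero. -/
lemma isIso_unit_square {g : Fin 2 × Fin 2 →o Fin 3 × Fin 3} (X : D.diag Two.{w})
    (h : g (1, 0) ∈ baseRegion ∧ ¬ g (1, 0) ≤ (0, 1)) :
    IsIso ((D.ranAdj Corner.row.{w}).unit.app
      ((D.pull Corner.incl).obj ((D.pull (Square.toGrid g)).obj (D.gridDiag.obj X)))) := by
  refine isIso_ranAdj_unit_app _ _ fun ⟨(⟨a⟩, ⟨b⟩), hc⟩ => ?_
  obtain rfl | rfl : a = 0 ∨ a = 1 := by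
    fin_cases a <;> simp
  · exact Or.inl ⟨⟨b⟩, rfl⟩
  · obtain rfl : b = 0 := by
      by_contra hb
      exact hc (by rw [Fin.eq_one_of_ne_zero b hb])
    refine Or.inr ⟨fun i => ⟨fun f => ?_⟩, ?_⟩
    · exact absurd (show (⟨1⟩ : Two) ≤ ⟨0⟩ from leOfHom f.hom.1) (by decide)
    · obtain ⟨t⟩ := D.isTerminal_gridDiag X _ h.1 h.2
      refine ⟨t.ofIso (eqToIso ?_)⟩
      rw [← pull_comp₃_obj]
      exact D.pull_congr_obj (functor_ext_of_isThin fun _ => rfl) _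

/-- In the shifted derivator, the corner of a prism is extended by zero from its vertex if the other
objects are prescribed to be zero. -/
lemma isIso_unit_prism {g : Fin 2 × Fin 2 × Fin 2 →o Fin 3 × Fin 3} (X : D.diag Two.{w})
    (h : ∀ t c, c ≠ (0, 0) → c ≠ (1, 1) → g (t, c) ∈ baseRegion ∧ ¬ g (t, c) ≤ (0, 1)) :
    IsIso ((D.ranAdj ((𝟭 Two.{w}).prod (pt Corner.zero.{w}))).unit.app
      ((D.pull ((𝟭 Two.{w}).prod Corner.incl)).obj
        ((D.pull (Prism.toGrid g)).obj (D.gridDiag.obj X)))) := by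
  refine isIso_ranAdj_unit_app _ _ fun ⟨t, c⟩ => ?_
  by_cases hc : c.val = (0, 0)
  · refine Or.inl ⟨(t, ⟨⟨⟩⟩), ?_⟩
    obtain ⟨⟨⟨a⟩, ⟨b⟩⟩, h'⟩ := c
    obtain rfl : a = 0 := congrArg Prod.fst hc
    obtain rfl : b = 0 := congrArg Prod.snd hc
    rfl
  · refine Or.inr ⟨fun i => ⟨fun f => hc ?_⟩, ?_⟩
    · exact le_bot_iff.1 ((Corner.nonempty_hom_iff _ _).1 ⟨f.2⟩)
    · obtain ⟨t⟩ := D.isTerminal_gridDiag X _ (h t.down c.val hc c.val_ne).1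
        (h t.down c.val hc c.val_ne).2
      refine ⟨t.ofIso (eqToIso ?_)⟩
      rw [← pull_comp₃_obj]
      exact D.pull_congr_obj (functor_ext_of_isThin fun _ => rfl) _

/-- On a cocartesian square of the grid diagram with a zero object at `(1, 0)`, the arrow `e'` at the
second coordinate `1` is the cofiber of the arrow `e` at the first coordinate `0`. -/
noncomputable def gridDiagCofiberIso {s : Finset (Fin 3 × Fin 3)}
    {g : Fin 2 × Fin 2 →o Fin 3 × Fin 3}
    (hs : baseRegion ⊆ s) (hg : IsPushoutShape s g)
    (h : g (1, 0) ∈ baseRegion ∧ ¬ g (1, 0) ≤ (0, 1)) {e e' : Two.{w} ⥤ Grid.{w}}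
    (he : e = Corner.row ⋙ Corner.incl ⋙ Square.toGrid g) (he' : e' = Square.col ⋙ Square.toGrid g) :
    D.gridDiag ⋙ D.pull e' ≅ (D.gridDiag ⋙ D.pull e) ⋙ D.cofiber :=
  eqToIso (by rw [he', pull_comp]; rfl) ≪≫
    Functor.isoWhiskerRight (isoRanLan (D.gridDiag ⋙ D.pull (Square.toGrid g)) Corner.row Corner.incl
      (fun X => isIso_counit_square hg (D.gridDiag_mem_essImage hs X))
      (fun X => D.isIso_unit_square X h)) (D.pull Square.col) ≪≫
    eqToIso (by rw [he, pull_comp, pull_comp]; rfl)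

/-- Both the third iterated cofiber and the suspension of a morphism of diagrams are the arrow
`Σ x ⟶ Σ y` at `(1, 2) ⟶ (2, 2)` of the grid diagram. -/
noncomputable def cofiberCubeIso : D.cofiber ⋙ D.cofiber ⋙ D.cofiber ≅
    (D.shiftUnderlying Two.{w}).inverse ⋙ (D.shift Two.{w}).suspension ⋙
      (D.shiftUnderlying Two.{w}).functor := by
  let c₁ := D.gridDiagCofiberIso subset_rfl isPushoutShape_square₁ (by decide)
    (e := baseRow ⋙ Region.incl baseRegion) (functor_ext_of_isThin fun _ => rfl) rfl
  let c₂ := D.gridDiagCofiberIso (by decide) isPushoutShape_square₂ (by decide)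
    (e := Square.col ⋙ Square.toGrid square₁) (functor_ext_of_isThin fun _ => rfl) rfl
  let c₃ := D.gridDiagCofiberIso (by decide) isPushoutShape_square₃ (by decide)
    (e := Square.col ⋙ Square.toGrid square₂) (functor_ext_of_isThin fun _ => rfl) rfl
  -- The restrictions in the suspension of the shift are the following restrictions in `D`.
  let Z := (𝟭 Two.{w}).prod (pt Corner.zero.{w})
  let I := (𝟭 Two.{w}).prod Corner.incl.{w}
  let V := (𝟭 Two.{w}).prod (pt ((⟨1⟩, ⟨1⟩) : Square.{w}))
  let S := CategoryTheory.Prod.sectL Two.{w} (⟨⟨⟩⟩ : One.{w})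
  let p := CategoryTheory.Prod.fst Two.{w} One.{w}
  let σ := isoRanLan (D.gridDiag ⋙ D.pull (Prism.toGrid prism)) Z I
    (fun X => isIso_counit_prism isPushoutShape_prism (D.gridDiag_mem_essImage subset_rfl X))
    (fun X => D.isIso_unit_prism X (by decide))
  -- Both constructions end with the arrow `(1, 2) ⟶ (2, 2)` of the grid.
  have h₁ : D.gridDiag ⋙ D.pull (Square.col ⋙ Square.toGrid square₃) =
      (D.gridDiag ⋙ D.pull (Prism.toGrid prism)) ⋙ D.pull V ⋙ D.pull S := by
    rw [show Square.col.{w} ⋙ Square.toGrid square₃ = S ⋙ V ⋙ Prism.toGrid prism from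
      functor_ext_of_isThin fun ⟨i⟩ => ?_]
    · rw [pull_comp, pull_comp]; rfl
    · fin_cases i <;> rfl
  have h₂ : (D.gridDiag ⋙ D.pull (Prism.toGrid prism)) ⋙ D.pull I ⋙ D.pull Z =
      (D.gridDiag ⋙ D.pull (baseRow ⋙ Region.incl baseRegion)) ⋙ D.pull p := by
    have : Z ⋙ I ⋙ Prism.toGrid prism = p ⋙ baseRow ⋙ Region.incl baseRegion :=
      functor_ext_of_isThin fun ⟨⟨i⟩, _⟩ => by fin_cases i <;> rfl
    have := congrArg D.pull this
    rw [pull_comp, pull_comp, pull_comp _ p] at this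
    exact congrArg (D.gridDiag ⋙ ·) this
  let τ := Functor.isoWhiskerRight D.gridDiagPullIso (D.pull p)
  let γ := Functor.isoWhiskerRight (Functor.isoWhiskerRight (Functor.isoWhiskerRight
    D.gridDiagPullIso D.cofiber) D.cofiber) D.cofiber
  let γ' := c₃ ≪≫ Functor.isoWhiskerRight (c₂ ≪≫ Functor.isoWhiskerRight c₁ D.cofiber) D.cofiber
  exact γ.symm ≪≫ γ'.symm ≪≫ eqToIso h₁ ≪≫
    Functor.isoWhiskerRight (σ ≪≫ Functor.isoWhiskerRight (eqToIso h₂ ≪≫ τ)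
      (D.ran Z ⋙ D.lan I)) (D.pull V ⋙ D.pull S)

end CoherentDiagram

end Prederivator

theorem mainTheorem8 (D : Prederivator.{w, v, u}) [D.IsPointedDerivator] :
    Nonempty (D.cofiber ⋙ D.cofiber ⋙ D.cofiber ≅
      (D.shiftUnderlying Prederivator.Two.{w}).inverse ⋙
        (D.shift Prederivator.Two.{w}).suspension ⋙
          (D.shiftUnderlying Prederivator.Two.{w}).functor) :=
  ⟨D.cofiberCubeIso⟩
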